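/- Let $\Omega\subset\mathbb R^2$ be a bounded strictly convex domain with smooth boundary, let $d$ be its inradius (the radius of the largest ball contained in $\Omega$), and let $\alpha>1$. Suppose $d<\pi/2$, and let $u\in C^2(\Omega)\cap C^0(\overline\Omega)$ be a classical solution of $$\operatorname{div}\left(\frac{\nabla u}{\sqrt{1+|\nabla u|^2}}\right)=\left(\frac{1}{\sqrt{1+|\nabla u|^2}}\right)^{\alpha}\ \text{ in }\Omega,\qquad u=0\ \text{ on }\partial\Omega .$$ Then $u_{\min}=\min_{\overline\Omega}u$ satisfies $$-u_{\min}\le\frac{1}{\alpha-1}\left(\left(\frac{1}{\cos d}\right)^{\alpha-1}-1\right).$$ -/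

import Mathlib

open scoped ContDiff

noncomputable section

/-- The Euclidean plane. -/
abbrev Plane : Type := EuclideanSpace ℝ (Fin 2)

/-- The boundary of `Ω` is smooth: near each of its points, `Ω` is the negativity set of a
smooth function with nonvanishing differential at that point. -/
def HasSmoothBoundary (Ω : Set Plane) : Prop :=
  ∀ p ∈ frontier Ω, ∃ (U : Set Plane) (ρ : Plane → ℝ),
    IsOpen U ∧ p ∈ U ∧ ContDiffOn ℝ ∞ ρ U ∧ fderiv ℝ ρ p ≠ 0 ∧
      Ω ∩ U = {x ∈ U | ρ x < 0}

/-- Bounded strictly convex planar domains with smooth boundary. Strict convexity is a condition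
on the closure (no boundary segments); for an open set `StrictConvex` alone would only say
`Convex`. It is implied by positivity of the curvature of the boundary. -/
structure IsSmoothStrictlyConvexDomain (Ω : Set Plane) : Prop where
  isOpen : IsOpen Ω
  nonempty : Ω.Nonempty
  isBounded : Bornology.IsBounded Ω
  convex : Convex ℝ Ω
  strictConvex_closure : StrictConvex ℝ (closure Ω)
  smoothBoundary : HasSmoothBoundary Ω

/-- The divergence of a planar vector field. -/
def divergence (F : Plane → Plane) (x : Plane) : ℝ :=
  ∑ i : Fin 2, (fderiv ℝ F x (EuclideanSpace.single i 1)) i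

/-- Classical solutions `u ∈ C²(Ω) ∩ C⁰(closure Ω)` of the Dirichlet problem
`div (∇u / √(1 + |∇u|²)) = (1 / √(1 + |∇u|²)) ^ α` in `Ω`, `u = 0` on `∂Ω`. -/
structure IsClassicalSolution (α : ℝ) (Ω : Set Plane) (u : Plane → ℝ) : Prop where
  contDiffOn : ContDiffOn ℝ 2 u Ω
  continuousOn : ContinuousOn u (closure Ω)
  equation : ∀ x ∈ Ω,
    divergence (fun y => (1 / √(1 + ‖gradient u y‖ ^ 2)) • gradient u y) x
      = (1 / √(1 + ‖gradient u x‖ ^ 2)) ^ α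
  boundary : ∀ x ∈ frontier Ω, u x = 0

/-- The inradius: the supremum of the radii of the balls contained in `Ω`. -/
def inradius (Ω : Set Plane) : ℝ :=
  sSup {r : ℝ | 0 < r ∧ ∃ x : Plane, Metric.ball x r ⊆ Ω}

end

/-!
For `α > 1` the right-hand side is at most `1 / √(1 + |∇u|²)`, with strict inequality where
`∇u ≠ 0`, so `u` is a supersolution of the translator equation `div (∇u / √(1 + |∇u|²)) =
1 / √(1 + |∇u|²)`, which is solved by every one-dimensional grim reaper `y ↦ -log cos (⟪e, y⟫ + b)`.
Take `c` between the inradius and `π / 2` and compare `u` with the barrier `-log cos (c - δ)`, where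
`δ` is the distance to the boundary. By convexity `δ` is touched from above by affine functions of
unit slope, so at an interior minimum of the difference a grim reaper would touch `u` from below
with nonzero slope, which ellipticity excludes. Hence the difference is minimal on the boundary,
where `δ = 0`, and `c` may decrease to the inradius.
-/

open Filter Set
open scoped RealInnerProductSpace Topology

section MinimumPoints

theorem second_deriv_nonneg_of_isLocalMin {g g' : ℝ → ℝ} {a c : ℝ} (hmin : IsLocalMin g a)
    (hg : ∀ᶠ t in 𝓝 a, HasDerivAt g (g' t) t) (hg' : HasDerivAt g' c a) : 0 ≤ c := by
  by_contra! hc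
  have hderiv : deriv g =ᶠ[𝓝 a] g' := hg.mono fun t ht => ht.deriv
  have hderiv₂ : deriv (deriv g) a = c := by rw [hderiv.deriv_eq, hg'.deriv]
  have hmax : IsLocalMax g a :=
    isLocalMax_of_deriv_deriv_neg (hderiv₂ ▸ hc) hmin.deriv_eq_zero hg.self_of_nhds.continuousAt
  have hconst : g =ᶠ[𝓝 a] fun _ => g a := by
    filter_upwards [hmin, hmax] with t h₁ h₂ using le_antisymm h₂ h₁
  have hzero : deriv (deriv g) a = 0 := by
    rw [hconst.deriv.deriv_eq]
    simp
  exact hc.ne (hderiv₂.symm.trans hzero)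

variable {E : Type*} [NormedAddCommGroup E] [InnerProductSpace ℝ E] [CompleteSpace E]
  {f g : E → ℝ} {x : E}

theorem inner_hessian_nonneg_of_isLocalMin {V : E → E} {H : E →L[ℝ] E} (hmin : IsLocalMin f x)
    (hf : ∀ᶠ y in 𝓝 x, HasGradientAt f (V y) y) (hV : HasFDerivAt V H x) (v : E) :
    0 ≤ ⟪H v, v⟫ := by
  have hline (t : ℝ) : HasDerivAt (fun t : ℝ => x + t • v) v t := by
    simpa using ((hasDerivAt_id t).smul_const v).const_add x
  have hline₀ : Tendsto (fun t : ℝ => x + t • v) (𝓝 0) (𝓝 x) := by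
    simpa using (hline 0).continuousAt.tendsto
  have hx : x + (0 : ℝ) • v = x := by simp
  refine second_deriv_nonneg_of_isLocalMin (g := fun t : ℝ => f (x + t • v))
    (g' := fun t => ⟪V (x + t • v), v⟫) (a := 0) ?_ ?_ ?_
  · filter_upwards [hline₀.eventually hmin] with t ht
    simpa using ht
  · filter_upwards [hline₀.eventually hf] with t ht
    exact ht.hasFDerivAt.comp_hasDerivAt t (hline t)
  · have hVline : HasDerivAt (fun t : ℝ => V (x + t • v)) (H v) 0 :=
      (hx.symm ▸ hV : HasFDerivAt V H (x + (0 : ℝ) • v)).comp_hasDerivAt 0 (hline 0)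
    simpa using hVline.inner ℝ (hasDerivAt_const (0 : ℝ) v)

theorem differentiableAt_gradient_of_contDiffAt (hf : ContDiffAt ℝ 2 f x) :
    DifferentiableAt ℝ (gradient f) x := by
  have hfderiv : DifferentiableAt ℝ (fderiv ℝ f) x :=
    (hf.fderiv_right (m := 1) (by norm_num)).differentiableAt (by norm_num)
  exact (InnerProductSpace.toDual ℝ E).symm.toContinuousLinearEquiv.differentiableAt.comp x hfderiv

theorem eventually_hasGradientAt_of_contDiffAt (hf : ContDiffAt ℝ 2 f x) :
    ∀ᶠ y in 𝓝 x, HasGradientAt f (gradient f y) y := by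
  filter_upwards [hf.eventually (by simp)] with y hy
  exact (hy.differentiableAt (by norm_num)).hasGradientAt

theorem gradient_eq_of_isLocalMin_sub (hf : DifferentiableAt ℝ f x) (hg : DifferentiableAt ℝ g x)
    (hmin : IsLocalMin (fun y => f y - g y) x) : gradient f x = gradient g x := by
  have hzero := hmin.hasFDerivAt_eq_zero (hf.hasFDerivAt.sub hg.hasFDerivAt)
  rw [gradient, gradient, sub_eq_zero.1 hzero]

end MinimumPoints

section Trace

variable {E : Type*} [NormedAddCommGroup E] [InnerProductSpace ℝ E] [FiniteDimensional ℝ E]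

theorem trace_nonneg_of_inner_nonneg {A : E →ₗ[ℝ] E} (hA : ∀ v, 0 ≤ ⟪A v, v⟫) :
    0 ≤ LinearMap.trace ℝ E A := by
  rw [A.trace_eq_sum_inner (stdOrthonormalBasis ℝ E)]
  exact Finset.sum_nonneg fun i _ => real_inner_comm (A _) _ ▸ hA _

theorem inner_le_trace_of_norm_eq_one {A : E →ₗ[ℝ] E} (hA : ∀ v, 0 ≤ ⟪A v, v⟫) {e : E}
    (he : ‖e‖ = 1) : ⟪A e, e⟫ ≤ LinearMap.trace ℝ E A := by
  have horth : Orthonormal ℝ ((↑) : ({e} : Set E) → E) := by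
    simpa [orthonormal_subtype_iff_ite] using he
  obtain ⟨s, b, hes, hb⟩ := horth.exists_orthonormalBasis_extension
  rw [A.trace_eq_sum_inner b, hb, real_inner_comm]
  exact Finset.single_le_sum (f := fun i : s => ⟪(i : E), A i⟫)
    (fun i _ => real_inner_comm (A i) (i : E) ▸ hA i) (Finset.mem_univ ⟨e, hes rfl⟩)

theorem inner_le_norm_sq_mul_trace {A : E →ₗ[ℝ] E} (hA : ∀ v, 0 ≤ ⟪A v, v⟫) (v : E) :
    ⟪A v, v⟫ ≤ ‖v‖ ^ 2 * LinearMap.trace ℝ E A := by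
  rcases eq_or_ne v 0 with rfl | hv
  · simp
  have hnorm : ‖v‖ ≠ 0 := norm_ne_zero_iff.2 hv
  have hunit := inner_le_trace_of_norm_eq_one hA (norm_smul_inv_norm (𝕜 := ℝ) hv)
  rw [map_smul, real_inner_smul_left, real_inner_smul_right] at hunit
  calc ⟪A v, v⟫ = ‖v‖ ^ 2 * (‖v‖⁻¹ * (‖v‖⁻¹ * ⟪A v, v⟫)) := by field_simp
    _ ≤ ‖v‖ ^ 2 * LinearMap.trace ℝ E A := by gcongr; exact hunit

theorem trace_smulRight_eq_apply (f : E →L[ℝ] ℝ) (v : E) :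
    LinearMap.trace ℝ E (f.smulRight v : E →L[ℝ] E) = f v :=
  LinearMap.trace_smulRight f.toLinearMap v

end Trace

section VerticalNormal

variable {E : Type*} [NormedAddCommGroup E]

/-- The vertical component of the upward unit normal to a graph whose gradient is `p`. -/
noncomputable def verticalNormal (p : E) : ℝ := 1 / √(1 + ‖p‖ ^ 2)

theorem verticalNormal_pos (p : E) : 0 < verticalNormal p := by
  unfold verticalNormal
  positivity

theorem verticalNormal_sq_mul (p : E) : verticalNormal p ^ 2 * (1 + ‖p‖ ^ 2) = 1 := by
  rw [verticalNormal, div_pow, Real.sq_sqrt (by positivity)]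
  field_simp

theorem verticalNormal_lt_one {p : E} (hp : p ≠ 0) : verticalNormal p < 1 := by
  have : 0 < ‖p‖ ^ 2 := by positivity
  rw [verticalNormal, div_lt_one (by positivity), Real.lt_sqrt zero_le_one]
  linarith

variable [InnerProductSpace ℝ E]

theorem hasFDerivAt_verticalNormal_smul {V : E → E} {H : E →L[ℝ] E} {x : E}
    (hV : HasFDerivAt V H x) :
    HasFDerivAt (fun y => verticalNormal (V y) • V y)
      (verticalNormal (V x) • H
        - verticalNormal (V x) ^ 3 • ((innerSL ℝ (V x)).comp H).smulRight (V x)) x := by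
  have hq : 0 < 1 + ‖V x‖ ^ 2 := by positivity
  have hs : 0 < √(1 + ‖V x‖ ^ 2) := Real.sqrt_pos.2 hq
  have hsqrt := (hV.norm_sq.const_add 1).sqrt hq.ne'
  have hinv := (hasDerivAt_inv hs.ne').comp_hasFDerivAt x hsqrt
  simp only [verticalNormal, one_div]
  refine (hinv.smul hV).congr_fderiv ?_
  ext v
  simp only [Function.comp_def, add_apply, smul_apply,
    ContinuousLinearMap.smulRight_apply, ContinuousLinearMap.comp_apply, innerSL_apply_apply,
    smul_eq_mul, sub_eq_add_neg, ← neg_smul, smul_smul]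
  congr 2
  field_simp
  rw [two_nsmul, two_mul]

end VerticalNormal

section MeanCurvature

variable {E : Type*} [NormedAddCommGroup E] [InnerProductSpace ℝ E] [FiniteDimensional ℝ E]
  {u w : E → ℝ} {x : E}

/-- The mean curvature operator `div (∇u / √(1 + |∇u|²))`, the divergence of a vector field being
the trace of its derivative. -/
noncomputable def meanCurvature (u : E → ℝ) (x : E) : ℝ :=
  LinearMap.trace ℝ E (fderiv ℝ (fun y => verticalNormal (gradient u y) • gradient u y) x)

theorem meanCurvature_eq {H : E →L[ℝ] E} (hH : HasFDerivAt (gradient u) H x) :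
    meanCurvature u x = verticalNormal (gradient u x) * LinearMap.trace ℝ E H
      - verticalNormal (gradient u x) ^ 3 * ⟪H (gradient u x), gradient u x⟫ := by
  rw [meanCurvature, (hasFDerivAt_verticalNormal_smul hH).fderiv]
  simp only [ContinuousLinearMap.toLinearMap_sub, ContinuousLinearMap.toLinearMap_smul, map_sub,
    map_smul, smul_eq_mul, trace_smulRight_eq_apply, ContinuousLinearMap.comp_apply,
    innerSL_apply_apply, real_inner_comm]

theorem meanCurvature_le_of_isLocalMin_sub (hu : ContDiffAt ℝ 2 u x) (hw : ContDiffAt ℝ 2 w x)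
    (hmin : IsLocalMin (fun y => u y - w y) x) : meanCurvature w x ≤ meanCurvature u x := by
  obtain ⟨Hu, hHu⟩ := differentiableAt_gradient_of_contDiffAt hu
  obtain ⟨Hw, hHw⟩ := differentiableAt_gradient_of_contDiffAt hw
  have hgrad := gradient_eq_of_isLocalMin_sub (hu.differentiableAt two_ne_zero)
    (hw.differentiableAt two_ne_zero) hmin
  have hsub : ∀ᶠ y in 𝓝 x,
      HasGradientAt (fun y => u y - w y) (gradient u y - gradient w y) y := by
    filter_upwards [eventually_hasGradientAt_of_contDiffAt hu,
      eventually_hasGradientAt_of_contDiffAt hw] with y hyu hyw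
    rw [hasGradientAt_iff_hasFDerivAt, map_sub]
    exact hyu.hasFDerivAt.sub hyw.hasFDerivAt
  have hA (v : E) : 0 ≤ ⟪((Hu - Hw : E →L[ℝ] E) : E →ₗ[ℝ] E) v, v⟫ :=
    inner_hessian_nonneg_of_isLocalMin hmin hsub (hHu.sub hHw) v
  have htrace := inner_le_norm_sq_mul_trace hA (gradient w x)
  have htrace₀ := trace_nonneg_of_inner_nonneg hA
  rw [meanCurvature_eq hHu, meanCurvature_eq hHw, hgrad]
  set p := gradient w x
  set k := verticalNormal p
  have hk : k = k ^ 3 * (1 + ‖p‖ ^ 2) := by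
    linear_combination -k * verticalNormal_sq_mul p
  have hk₀ : 0 < k := verticalNormal_pos p
  simp only [ContinuousLinearMap.toLinearMap_sub, map_sub, LinearMap.sub_apply, inner_sub_left,
    ContinuousLinearMap.coe_coe] at htrace htrace₀
  -- With `A = Hu - Hw`, this is `0 ≤ (1 + ‖p‖²) tr A - ⟪A p, p⟫`, the ellipticity of the operator.
  have hdiff : 0 ≤ k ^ 3 * ((1 + ‖p‖ ^ 2) * (LinearMap.trace ℝ E Hu - LinearMap.trace ℝ E Hw)
      - (⟪Hu p, p⟫ - ⟪Hw p, p⟫)) := mul_nonneg (by positivity) (by linarith)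
  linear_combination hdiff - (LinearMap.trace ℝ E Hu - LinearMap.trace ℝ E Hw) * hk

theorem gradient_eq_zero_of_isLocalMin_sub_translator {α : ℝ} (hα : 1 < α) (hu : ContDiffAt ℝ 2 u x)
    (hw : ContDiffAt ℝ 2 w x) (hu_super : meanCurvature u x ≤ verticalNormal (gradient u x) ^ α)
    (hw_sub : verticalNormal (gradient w x) ≤ meanCurvature w x)
    (hmin : IsLocalMin (fun y => u y - w y) x) : gradient w x = 0 := by
  by_contra hne
  rw [gradient_eq_of_isLocalMin_sub (hu.differentiableAt two_ne_zero)
    (hw.differentiableAt two_ne_zero) hmin] at hu_super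
  have hpow := Real.rpow_lt_rpow_of_exponent_gt (verticalNormal_pos (gradient w x))
    (verticalNormal_lt_one hne) hα
  rw [Real.rpow_one] at hpow
  exact absurd (meanCurvature_le_of_isLocalMin_sub hu hw hmin)
    (hu_super.trans_lt (hpow.trans_le hw_sub)).not_ge

end MeanCurvature

section PlaneWaves

variable {E : Type*} [NormedAddCommGroup E] [InnerProductSpace ℝ E] {G G' : ℝ → ℝ} {b c : ℝ}
  {e x : E}

theorem hasGradientAt_comp_inner_add [CompleteSpace E] (hG : HasDerivAt G c (⟪e, x⟫ + b)) :
    HasGradientAt (fun y => G (⟪e, y⟫ + b)) (c • e) x := by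
  rw [hasGradientAt_iff_hasFDerivAt, map_smul]
  exact hG.comp_hasFDerivAt x ((innerSL ℝ e).hasFDerivAt.add_const b)

theorem meanCurvature_comp_inner_add [FiniteDimensional ℝ E] (he : ‖e‖ = 1)
    (hG : ∀ᶠ t in 𝓝 (⟪e, x⟫ + b), HasDerivAt G (G' t) t)
    (hG' : HasDerivAt G' c (⟪e, x⟫ + b)) :
    meanCurvature (fun y => G (⟪e, y⟫ + b)) x = c * verticalNormal (G' (⟪e, x⟫ + b) • e) ^ 3 := by
  have hcont : ContinuousAt (fun y => ⟪e, y⟫ + b) x := by fun_prop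
  have hgrad : gradient (fun y => G (⟪e, y⟫ + b)) =ᶠ[𝓝 x] fun y => G' (⟪e, y⟫ + b) • e := by
    filter_upwards [hcont.eventually hG] with y hy
    exact (hasGradientAt_comp_inner_add hy).gradient
  have hess : HasFDerivAt (gradient fun y => G (⟪e, y⟫ + b))
      ((c • innerSL ℝ e).smulRight e) x :=
    ((hG'.comp_hasFDerivAt x ((innerSL ℝ e).hasFDerivAt.add_const b)).smul_const
      e).congr_of_eventuallyEq hgrad
  rw [meanCurvature_eq hess, hgrad.self_of_nhds]
  set g := G' (⟪e, x⟫ + b)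
  have hk := verticalNormal_sq_mul (g • e)
  have hee : ⟪e, e⟫ = (1 : ℝ) := by rw [real_inner_self_eq_norm_sq, he, one_pow]
  rw [norm_smul, he, mul_one, Real.norm_eq_abs, sq_abs] at hk
  simp only [trace_smulRight_eq_apply, ContinuousLinearMap.smulRight_apply, smul_apply,
    innerSL_apply_apply, real_inner_smul_left, real_inner_smul_right, smul_eq_mul, hee]
  linear_combination -(c * verticalNormal (g • e)) * hk

end PlaneWaves

section GrimReaper

/-- The grim reaper curve, the graph over `(-π / 2, π / 2)` that moves by translation under the
curve shortening flow. -/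
noncomputable def grimReaper (t : ℝ) : ℝ := -Real.log (Real.cos t)

variable {t : ℝ}

theorem hasDerivAt_grimReaper (ht : Real.cos t ≠ 0) : HasDerivAt grimReaper (Real.tan t) t := by
  refine ((Real.hasDerivAt_cos t).log ht).neg.congr_deriv ?_
  rw [Real.tan_eq_sin_div_cos]
  ring

theorem grimReaper_nonneg (ht : 0 ≤ Real.cos t) : 0 ≤ grimReaper t :=
  neg_nonneg.2 (Real.log_nonpos ht (Real.cos_le_one t))

theorem monotoneOn_grimReaper : MonotoneOn grimReaper (Ico 0 (Real.pi / 2)) := by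
  intro s hs t ht hst
  have hpi := Real.pi_pos
  have hcos : 0 < Real.cos t := Real.cos_pos_of_mem_Ioo ⟨by linarith [ht.1], ht.2⟩
  exact neg_le_neg (Real.log_le_log hcos
    (Real.cos_le_cos_of_nonneg_of_le_pi hs.1 (by linarith [ht.2]) hst))

variable {E : Type*} [NormedAddCommGroup E] [InnerProductSpace ℝ E] {b : ℝ} {e x : E}

theorem contDiffAt_grimReaper_comp_inner_add {n : WithTop ℕ∞} (h : Real.cos (⟪e, x⟫ + b) ≠ 0) :
    ContDiffAt ℝ n (fun y => grimReaper (⟪e, y⟫ + b)) x := by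
  have hinner : ContDiffAt ℝ n (fun y => ⟪e, y⟫ + b) x :=
    (innerSL ℝ e).contDiff.contDiffAt.add contDiffAt_const
  exact (hinner.cos.log h).neg

theorem meanCurvature_grimReaper_comp_inner_add [FiniteDimensional ℝ E] (he : ‖e‖ = 1)
    (h : 0 < Real.cos (⟪e, x⟫ + b)) :
    meanCurvature (fun y => grimReaper (⟪e, y⟫ + b)) x
      = verticalNormal (gradient (fun y => grimReaper (⟪e, y⟫ + b)) x) := by
  have hderiv : ∀ᶠ t in 𝓝 (⟪e, x⟫ + b), HasDerivAt grimReaper (Real.tan t) t := by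
    filter_upwards [Real.continuous_cos.continuousAt.eventually_ne h.ne'] with t ht
    exact hasDerivAt_grimReaper ht
  rw [meanCurvature_comp_inner_add he hderiv (Real.hasDerivAt_tan h.ne'),
    (hasGradientAt_comp_inner_add hderiv.self_of_nhds).gradient]
  have hcos : verticalNormal (Real.tan (⟪e, x⟫ + b) • e) = Real.cos (⟪e, x⟫ + b) := by
    rw [verticalNormal, norm_smul, he, mul_one, Real.norm_eq_abs, sq_abs, one_div,
      Real.inv_sqrt_one_add_tan_sq h]
  rw [hcos]
  field_simp

end GrimReaper

section InnerDistance

theorem exists_infDist_compl_le_sub_inner {E : Type*} [NormedAddCommGroup E]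
    [InnerProductSpace ℝ E] [FiniteDimensional ℝ E] {Ω : Set E} (hconv : Convex ℝ Ω)
    (hopen : IsOpen Ω) (hcompl : Ωᶜ.Nonempty) {x : E} (hx : x ∈ Ω) :
    ∃ (e : E) (b : ℝ), ‖e‖ = 1 ∧ (∀ y ∈ Ω, Metric.infDist y Ωᶜ ≤ b - ⟪e, y⟫) ∧
      Metric.infDist x Ωᶜ = b - ⟪e, x⟫ := by
  obtain ⟨p, hp, hpx⟩ := hopen.isClosed_compl.exists_infDist_eq_dist hcompl x
  obtain ⟨f, hf⟩ := geometric_hahn_banach_open_point hconv hopen hp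
  obtain ⟨n, rfl⟩ := (InnerProductSpace.toDual ℝ E).surjective f
  simp only [InnerProductSpace.toDual_apply_apply] at hf
  have hn : n ≠ 0 := by
    rintro rfl
    simpa using hf x hx
  have he : ‖‖n‖⁻¹ • n‖ = 1 := norm_smul_inv_norm (𝕜 := ℝ) hn
  have hsupport : ∀ y ∈ Ω, ⟪‖n‖⁻¹ • n, y⟫ < ⟪‖n‖⁻¹ • n, p⟫ := fun y hy => by
    rw [real_inner_smul_left, real_inner_smul_left]
    have := hf y hy
    gcongr
  generalize ‖n‖⁻¹ • n = e at he hsupport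
  have hle : ∀ y ∈ Ω, Metric.infDist y Ωᶜ ≤ ⟪e, p⟫ - ⟪e, y⟫ := fun y hy => by
    have hproj : y + (⟪e, p⟫ - ⟪e, y⟫) • e ∈ Ωᶜ := fun hmem => by
      have := hsupport _ hmem
      rw [inner_add_right, real_inner_smul_right, real_inner_self_eq_norm_sq, he] at this
      linarith
    refine (Metric.infDist_le_dist_of_mem hproj).trans_eq ?_
    rw [dist_self_add_right, norm_smul, he, mul_one, Real.norm_of_nonneg]
    exact sub_nonneg.2 (hsupport y hy).le
  refine ⟨e, ⟪e, p⟫, he, hle, (hle x hx).antisymm ?_⟩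
  rw [hpx, ← inner_sub_right, dist_comm, dist_eq_norm]
  simpa [he] using real_inner_le_norm e (p - x)

end InnerDistance

section Supersolutions

variable {E : Type*} [NormedAddCommGroup E] [InnerProductSpace ℝ E] [FiniteDimensional ℝ E]
  {α : ℝ} {Ω : Set E} {u : E → ℝ}

/-- Classical supersolutions of the Dirichlet problem of `IsClassicalSolution`, in a Euclidean
space of arbitrary dimension. -/
structure IsClassicalSupersolution (α : ℝ) (Ω : Set E) (u : E → ℝ) : Prop where
  contDiffOn : ContDiffOn ℝ 2 u Ω
  continuousOn : ContinuousOn u (closure Ω)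
  meanCurvature_le : ∀ x ∈ Ω, meanCurvature u x ≤ verticalNormal (gradient u x) ^ α
  boundary_nonneg : ∀ x ∈ frontier Ω, 0 ≤ u x

namespace IsClassicalSupersolution

theorem not_isLocalMin_sub_grimReaper (hu : IsClassicalSupersolution α Ω u) (hα : 1 < α)
    (hopen : IsOpen Ω) {e x : E} {b : ℝ} (hx : x ∈ Ω) (he : ‖e‖ = 1)
    (ht : ⟪e, x⟫ + b ∈ Ioo 0 (Real.pi / 2)) :
    ¬ IsLocalMin (fun y => u y - grimReaper (⟪e, y⟫ + b)) x := by
  intro hmin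
  have hcos : 0 < Real.cos (⟪e, x⟫ + b) :=
    Real.cos_pos_of_mem_Ioo ⟨by linarith [ht.1, Real.pi_pos], ht.2⟩
  have hgrad := gradient_eq_zero_of_isLocalMin_sub_translator hα
    (hu.contDiffOn.contDiffAt (hopen.mem_nhds hx)) (contDiffAt_grimReaper_comp_inner_add hcos.ne')
    (hu.meanCurvature_le x hx) (meanCurvature_grimReaper_comp_inner_add he hcos).ge hmin
  rw [(hasGradientAt_comp_inner_add (hasDerivAt_grimReaper hcos.ne')).gradient] at hgrad
  exact smul_ne_zero (Real.tan_pos_of_pos_of_lt_pi_div_two ht.1 ht.2).ne'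
    (norm_ne_zero_iff.1 (he ▸ one_ne_zero)) hgrad

theorem notMem_of_isMinOn_sub_grimReaper_infDist (hu : IsClassicalSupersolution α Ω u)
    (hα : 1 < α) (hopen : IsOpen Ω) (hconv : Convex ℝ Ω) (hcompl : Ωᶜ.Nonempty) {c : ℝ}
    (hc : c < Real.pi / 2) (hdist : ∀ y, Metric.infDist y Ωᶜ < c) {x : E}
    (hmin : IsMinOn (fun y => u y - grimReaper (c - Metric.infDist y Ωᶜ)) Ω x) : x ∉ Ω := by
  intro hx
  obtain ⟨e, b, he, hle, heq⟩ := exists_infDist_compl_le_sub_inner hconv hopen hcompl hx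
  have hwave : ⟪e, x⟫ + (c - b) = c - Metric.infDist x Ωᶜ := by rw [heq]; ring
  have hmem (y : E) : c - Metric.infDist y Ωᶜ ∈ Ioo 0 (Real.pi / 2) :=
    ⟨sub_pos.2 (hdist y), (sub_le_self c Metric.infDist_nonneg).trans_lt hc⟩
  have hwave_mem : ⟪e, x⟫ + (c - b) ∈ Ioo 0 (Real.pi / 2) := hwave ▸ hmem x
  refine hu.not_isLocalMin_sub_grimReaper hα hopen hx he hwave_mem ?_
  have hcont : ContinuousAt (fun y => ⟪e, y⟫ + (c - b)) x := by fun_prop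
  filter_upwards [hopen.mem_nhds hx, hcont.eventually_const_lt hwave_mem.1] with y hy hypos
  have hwave_le : ⟪e, y⟫ + (c - b) ≤ c - Metric.infDist y Ωᶜ := by linarith [hle y hy]
  calc u x - grimReaper (⟪e, x⟫ + (c - b)) = u x - grimReaper (c - Metric.infDist x Ωᶜ) := by
        rw [hwave]
    _ ≤ u y - grimReaper (c - Metric.infDist y Ωᶜ) := hmin hy
    _ ≤ u y - grimReaper (⟪e, y⟫ + (c - b)) := sub_le_sub_left (monotoneOn_grimReaper
        ⟨hypos.le, hwave_le.trans_lt (hmem y).2⟩ (Ioo_subset_Ico_self (hmem y)) hwave_le) _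

theorem neg_grimReaper_le (hu : IsClassicalSupersolution α Ω u) (hα : 1 < α) (hopen : IsOpen Ω)
    (hbdd : Bornology.IsBounded Ω) (hconv : Convex ℝ Ω) (hcompl : Ωᶜ.Nonempty) {c : ℝ}
    (hc : c < Real.pi / 2) (hdist : ∀ y, Metric.infDist y Ωᶜ < c) {z : E} (hz : z ∈ closure Ω) :
    -grimReaper c ≤ u z := by
  have hcos (y : E) : 0 < Real.cos (c - Metric.infDist y Ωᶜ) := Real.cos_pos_of_mem_Ioo
    ⟨by linarith [hdist y, Real.pi_pos], by linarith [Metric.infDist_nonneg (x := y) (s := Ωᶜ)]⟩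
  have hbarrier : Continuous fun y => grimReaper (c - Metric.infDist y Ωᶜ) :=
    ((Real.continuous_cos.comp (by fun_prop)).log fun y => (hcos y).ne').neg
  obtain ⟨x, hx, hmin⟩ := hbdd.isCompact_closure.exists_isMinOn ⟨z, hz⟩
    (hu.continuousOn.sub hbarrier.continuousOn)
  have hxΩ : x ∉ Ω := hu.notMem_of_isMinOn_sub_grimReaper_infDist hα hopen hconv hcompl hc hdist
    (hmin.on_subset subset_closure)
  have hux : 0 ≤ u x := hu.boundary_nonneg x (hopen.frontier_eq ▸ ⟨hx, hxΩ⟩)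
  have hminz : u x - grimReaper (c - Metric.infDist x Ωᶜ)
      ≤ u z - grimReaper (c - Metric.infDist z Ωᶜ) := hmin hz
  rw [Metric.infDist_zero_of_mem hxΩ, sub_zero] at hminz
  linarith [grimReaper_nonneg (hcos z).le]

end IsClassicalSupersolution

/-- The bound on distances to the complement says that `d` is at least the inradius of `Ω`. -/
theorem theorem6p1_general [Nontrivial E] (hα : 1 < α) (hopen : IsOpen Ω) (hne : Ω.Nonempty)
    (hbdd : Bornology.IsBounded Ω) (hconv : Convex ℝ Ω) {d : ℝ}
    (hdist : ∀ x, Metric.infDist x Ωᶜ ≤ d) (hd : d < Real.pi / 2)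
    (hu : IsClassicalSupersolution α Ω u) :
    ∃ umin : ℝ, IsLeast (u '' closure Ω) umin ∧ -umin ≤ Real.log (1 / Real.cos d) := by
  have himage : IsCompact (u '' closure Ω) :=
    hbdd.isCompact_closure.image_of_continuousOn hu.continuousOn
  obtain ⟨_, hleast⟩ := himage.exists_isLeast (hne.closure.image u)
  obtain ⟨z, hz, rfl⟩ := hleast.1
  refine ⟨u z, hleast, ?_⟩
  have hcompl : Ωᶜ.Nonempty := nonempty_compl.2 fun h =>
    NormedSpace.unbounded_univ ℝ E (h ▸ hbdd)
  have hd₀ : 0 ≤ d := Metric.infDist_nonneg.trans (hdist z)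
  have hcos : Real.cos d ≠ 0 :=
    (Real.cos_pos_of_mem_Ioo ⟨by linarith [Real.pi_pos], hd⟩).ne'
  have hlim : Tendsto grimReaper (𝓝[>] d) (𝓝 (grimReaper d)) :=
    (hasDerivAt_grimReaper hcos).continuousAt.tendsto.mono_left nhdsWithin_le_nhds
  rw [one_div, Real.log_inv]
  refine ge_of_tendsto hlim ?_
  filter_upwards [Ioo_mem_nhdsGT hd] with c hc
  exact neg_le.1 (hu.neg_grimReaper_le hα hopen hbdd hconv hcompl hc.2
    (fun y => (hdist y).trans_lt hc.1) hz)

end Supersolutions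

section Plane

theorem divergence_eq_trace (F : Plane → Plane) (x : Plane) :
    divergence F x = LinearMap.trace ℝ Plane (fderiv ℝ F x) := by
  rw [LinearMap.trace_eq_sum_inner _ (EuclideanSpace.basisFun (Fin 2) ℝ)]
  simp [divergence, EuclideanSpace.inner_single_left]

theorem IsClassicalSolution.isClassicalSupersolution {α : ℝ} {Ω : Set Plane} {u : Plane → ℝ}
    (hu : IsClassicalSolution α Ω u) : IsClassicalSupersolution α Ω u where
  contDiffOn := hu.contDiffOn
  continuousOn := hu.continuousOn
  meanCurvature_le x hx := ((divergence_eq_trace _ x).symm.trans (hu.equation x hx)).le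
  boundary_nonneg x hx := (hu.boundary x hx).ge

theorem inradius_nonneg (Ω : Set Plane) : 0 ≤ inradius Ω := Real.sSup_nonneg fun _ hr => hr.1.le

theorem infDist_compl_le_inradius {Ω : Set Plane} (hbdd : Bornology.IsBounded Ω) (x : Plane) :
    Metric.infDist x Ωᶜ ≤ inradius Ω := by
  rcases (Metric.infDist_nonneg (x := x) (s := Ωᶜ)).eq_or_lt with h | h
  · exact h ▸ inradius_nonneg Ω
  refine le_csSup ⟨Metric.diam Ω, ?_⟩ ⟨h, x, Metric.ball_infDist_compl_subset⟩
  rintro r ⟨hr, y, hball⟩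
  have hdiam := Metric.diam_mono hball hbdd
  rw [Metric.diam_ball_eq y hr.le] at hdiam
  linarith

end Plane

theorem log_le_one_div_mul_rpow_sub_one {x p : ℝ} (hx : 0 < x) (hp : 0 < p) :
    Real.log x ≤ 1 / p * (x ^ p - 1) := by
  have hlog := Real.log_le_sub_one_of_pos (Real.rpow_pos_of_pos hx p)
  rw [Real.log_rpow hx] at hlog
  rwa [one_div, ← div_eq_inv_mul, le_div_iff₀' hp]

theorem theorem6p1 (α : ℝ) (hα : 1 < α) (Ω : Set Plane)
    (hΩ : IsSmoothStrictlyConvexDomain Ω) (hd : inradius Ω < Real.pi / 2)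
    (u : Plane → ℝ) (hu : IsClassicalSolution α Ω u) :
    ∃ umin : ℝ, IsLeast (u '' closure Ω) umin ∧
      -umin ≤ 1 / (α - 1) * ((1 / Real.cos (inradius Ω)) ^ (α - 1) - 1) := by
  obtain ⟨umin, hleast, hle⟩ := theorem6p1_general hα hΩ.isOpen hΩ.nonempty hΩ.isBounded hΩ.convex
    (infDist_compl_le_inradius hΩ.isBounded) hd hu.isClassicalSupersolution
  have hcos : 0 < Real.cos (inradius Ω) :=
    Real.cos_pos_of_mem_Ioo ⟨by linarith [inradius_nonneg Ω, Real.pi_pos], hd⟩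
  exact ⟨umin, hleast, hle.trans
    (log_le_one_div_mul_rpow_sub_one (one_div_pos.2 hcos) (sub_pos.2 hα))⟩
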